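/- Let $G$ be a discrete group generated by $g_1,\dots,g_n$. Let $\mathcal G$ be the Cayley graph with vertex set $G$ and with one edge $(h,j)$ from $h$ to $hg_j$ for each $h\in G$ and $1\le j\le n$, and let $X$ be the simply connected 2-complex obtained from $\mathcal G$ by gluing one 2-cell along every (based) edge loop of positive length; $G$ acts freely on $X$ by left translation. Let $\partial_i$ be the boundary maps on the finitely supported complex cellular chains $C_i(X,\mathbb C)$, and let $\hat\partial_1$ be the continuous extension of $\partial_1$ to $C_1^{(2)}=\ell^2(\text{edges})\cong\ell^2(G)^{\oplus n}\to C_0^{(2)}=\ell^2(G)$. Let $\dim_{L(G)}$ be the Murray–von Neumann dimension of closed $G$-invariant subspaces of $\ell^2(G)^{\oplus m}$, that is, the von Neumann trace of the orthogonal projection. The first two $\ell^2$-Betti numbers of $G$ are $$\beta_0(G)=\dim_{L(G)}\big(C_0^{(2)}/\overline{\operatorname{im}\hat\partial_1}\big),\qquad \beta_1(G)=\sup_{F}\inf_{F'\supseteq F}\dim_{L(G)}\big(\ker\hat\partial_1/\overline{\operatorname{im}(\hat\partial_2|_{X_{F'}})}\big),$$ where $F,F'$ run over the finite sets of $G$-orbits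 of 2-cells, $X_F\subset X$ is the subcomplex consisting of $\mathcal G$ and the 2-cells in $F$, and $\hat\partial_2|_{X_F}$ is the continuous extension of $\partial_2$ to the square-summable 2-chains of $X_F$. For $f:G\to\mathbb C$ let $\delta f(h,j)=f(hg_j)-f(h)$. Then $$\beta_1(G)-\beta_0(G)+1 \;=\; n-\dim_{L(G)}\overline{\ker\partial_1}\;=\;\dim_{L(G)}\overline{\{\delta f : f\in\ell^\infty(G),\ \delta f\in \ell^2(\text{edges})\}},$$ where $\ker\partial_1$ is the space of finitely supported 1-cycles and both closures are taken in $\ell^2(\text{edges})$. -/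

import Mathlib

open scoped ENNReal InnerProductSpace

noncomputable section

namespace L2Betti

/-! ### Square-summable chains on free `G`-sets with finitely many orbits

A free `G`-set of cells is written `G × ι`, with `ι` indexing the orbits and `G` acting by left
translation on the first factor. -/

/-- The Hilbert space `ℓ²(S)` of square-summable complex functions on `S`. -/
abbrev Ell2 (S : Type*) : Type _ := lp (fun _ : S => ℂ) 2

/-- The inclusion of the finitely supported chains into `ℓ²(S)`. -/
def toL2 {S : Type*} : (S →₀ ℂ) →ₗ[ℂ] Ell2 S where
  toFun x := ⟨⇑x, (memℓp_zero_iff.2 x.hasFiniteSupport).of_exponent_ge zero_le⟩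
  map_add' _ _ := rfl
  map_smul' _ _ := rfl

@[simp] theorem toL2_apply {S : Type*} (x : S →₀ ℂ) (s : S) : toL2 x s = x s := rfl

theorem denseRange_toL2 {S : Type*} : DenseRange (toL2 : (S →₀ ℂ) →ₗ[ℂ] Ell2 S) := by
  classical
  intro f
  refine mem_closure_of_tendsto (lp.hasSum_single (by norm_num) f) (.of_forall fun s => ?_)
  refine ⟨∑ i ∈ s, Finsupp.single i (f i), ?_⟩
  rw [map_sum]
  refine Finset.sum_congr rfl fun i _ => ?_
  ext j
  rw [toL2_apply, lp.single_apply, Finsupp.single_apply]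
  by_cases h : i = j
  · subst h; simp
  · rw [if_neg h, Pi.single_eq_of_ne (Ne.symm h)]

theorem norm_sq_eq_tsum {S : Type*} (f : Ell2 S) : ‖f‖ ^ 2 = ∑' s, ‖f s‖ ^ 2 := by
  have h := lp.norm_rpow_eq_tsum (p := 2) (by norm_num) f
  simpa using h

theorem summable_norm_sq {S : Type*} (f : Ell2 S) : Summable fun s => ‖f s‖ ^ 2 := by
  have h := (lp.memℓp f).summable (by norm_num)
  simpa using h

/-- Left translation by `x` on `ℓ²(G × ι)`; it moves the basis vector at `(h, i)` to the one at
`(x * h, i)`. -/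
def translate {G ι : Type*} [Group G] (x : G) : Ell2 (G × ι) ≃ₗᵢ[ℂ] Ell2 (G × ι) where
  toFun f := ⟨fun p => f (x⁻¹ * p.1, p.2), by
    refine memℓp_gen ?_
    have h := summable_norm_sq f
    have h' := h.comp_injective (i := fun p : G × ι => (x⁻¹ * p.1, p.2))
      (fun p q hpq => by simpa [Prod.ext_iff] using hpq)
    simpa [Function.comp_def] using h'⟩
  invFun f := ⟨fun p => f (x * p.1, p.2), by
    refine memℓp_gen ?_
    have h := summable_norm_sq f
    have h' := h.comp_injective (i := fun p : G × ι => (x * p.1, p.2))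
      (fun p q hpq => by simpa [Prod.ext_iff] using hpq)
    simpa [Function.comp_def] using h'⟩
  left_inv f := by ext p; simp
  right_inv f := by ext p; simp
  map_add' _ _ := rfl
  map_smul' _ _ := rfl
  norm_map' f := by
    rw [← sq_eq_sq₀ (norm_nonneg _) (norm_nonneg _), norm_sq_eq_tsum, norm_sq_eq_tsum]
    exact ((Equiv.mulLeft x⁻¹).prodCongr (Equiv.refl ι)).tsum_eq (fun p => ‖f p‖ ^ 2)

@[simp] theorem translate_apply {G ι : Type*} [Group G] (x : G) (f : Ell2 (G × ι)) (p : G × ι) :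
    translate x f p = f (x⁻¹ * p.1, p.2) := rfl

theorem inner_translate {G ι : Type*} [Group G] (x : G) (u v : Ell2 (G × ι)) :
    ⟪u, translate x v⟫_ℂ = ⟪translate x⁻¹ u, v⟫_ℂ := by
  rw [← (translate x).inner_map_map (translate x⁻¹ u) v]
  congr 1
  ext p
  simp

/-- Left translation by `x` on finitely supported chains. -/
def shift {G ι : Type*} [Group G] (x : G) : (G × ι →₀ ℂ) →ₗ[ℂ] (G × ι →₀ ℂ) :=
  Finsupp.lmapDomain ℂ ℂ fun p => (x * p.1, p.2)

@[simp] theorem shift_single {G ι : Type*} [Group G] (x : G) (p : G × ι) (a : ℂ) :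
    shift x (Finsupp.single p a) = Finsupp.single (x * p.1, p.2) a := by
  simp [shift]

theorem toL2_shift {G ι : Type*} [Group G] (x : G) (c : G × ι →₀ ℂ) :
    toL2 (shift x c) = translate x (toL2 c) := by
  ext p
  have hinj : Function.Injective fun p : G × ι => (x * p.1, p.2) :=
    fun p q hpq => by simpa [Prod.ext_iff] using hpq
  have h := Finsupp.mapDomain_apply hinj c (x⁻¹ * p.1, p.2)
  simpa [shift] using h

/-! ### Hilbert modules and von Neumann dimension -/

/-- A closed `G`-invariant subspace of `ℓ²(G × ι) = ⨁_ι ℓ²(G)`; equivalently, a closed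
submodule for the left action of the group von Neumann algebra `L(G)`. -/
structure HilbertSubmodule (G ι : Type*) [Group G] where
  /-- the underlying subspace -/
  carrier : Submodule ℂ (Ell2 (G × ι))
  isClosed' : IsClosed (carrier : Set (Ell2 (G × ι)))
  translate_mem' : ∀ (x : G), ∀ f ∈ carrier, translate x f ∈ carrier

namespace HilbertSubmodule

variable {G ι κ : Type*} [Group G]

/-- The orthogonal projection of `ℓ²(G × ι)` onto a closed invariant subspace. -/
def proj (V : HilbertSubmodule G ι) : Ell2 (G × ι) →L[ℂ] Ell2 (G × ι) :=
  haveI : CompleteSpace V.carrier := V.isClosed'.completeSpace_coe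
  V.carrier.starProjection

/-- The Murray–von Neumann dimension `dim_{L(G)} V`: the von Neumann trace
`∑ᵢ ⟨P δ_{(1,i)}, δ_{(1,i)}⟩` of the projection `P` onto `V`. -/
def dim [Fintype ι] (V : HilbertSubmodule G ι) : ℝ :=
  ∑ i : ι, RCLike.re
    ⟪toL2 (Finsupp.single ((1 : G), i) 1), V.proj (toL2 (Finsupp.single ((1 : G), i) 1))⟫_ℂ

/-- The closure of an invariant subspace. -/
def closure (S : Submodule ℂ (Ell2 (G × ι))) (hS : ∀ (x : G), ∀ f ∈ S, translate x f ∈ S) :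
    HilbertSubmodule G ι where
  carrier := S.topologicalClosure
  isClosed' := S.isClosed_topologicalClosure
  translate_mem' x _ hf :=
    map_mem_closure (translate (ι := ι) x).continuous hf (fun a ha => hS x a ha)

/-- The orthogonal complement. -/
def orthogonal (V : HilbertSubmodule G ι) : HilbertSubmodule G ι where
  carrier := V.carrierᗮ
  isClosed' := V.carrier.isClosed_orthogonal
  translate_mem' x f hf := by
    rw [Submodule.mem_orthogonal] at hf ⊢
    intro u hu
    rw [inner_translate]
    exact hf _ (V.translate_mem' _ _ hu)

/-- The intersection. -/
def inf (V W : HilbertSubmodule G ι) : HilbertSubmodule G ι where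
  carrier := V.carrier ⊓ W.carrier
  isClosed' := V.isClosed'.inter W.isClosed'
  translate_mem' x f hf := ⟨V.translate_mem' x f hf.1, W.translate_mem' x f hf.2⟩

end HilbertSubmodule

/-! ### Equivariant chain maps and their `ℓ²`-extensions -/

/-- A `G`-equivariant linear map between the spaces of finitely supported chains on the free
`G`-sets `G × κ` and `G × ι`. -/
structure EquivariantMap (G κ ι : Type*) [Group G] where
  /-- the underlying linear map -/
  toLin : (G × κ →₀ ℂ) →ₗ[ℂ] (G × ι →₀ ℂ)
  map_shift' : ∀ (x : G) (c : G × κ →₀ ℂ), toLin (shift x c) = shift x (toLin c)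

namespace EquivariantMap

variable {G κ ι : Type*} [Group G]

/-- The continuous extension `T̂ : ℓ²(G × κ) → ℓ²(G × ι)` of an equivariant map `T` of finitely
supported chains; it exists when `κ` is finite, see `hat_toL2`. -/
def hat (T : EquivariantMap G κ ι) : Ell2 (G × κ) →L[ℂ] Ell2 (G × ι) :=
  (toL2 ∘ₗ T.toLin).extendOfNorm toL2

theorem norm_toL2_mapDomain {S S' : Type*} (φ : S → S') (hφ : Function.Injective φ) (x : S →₀ ℂ) :
    ‖toL2 (Finsupp.mapDomain φ x)‖ = ‖toL2 x‖ := by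
  rw [← sq_eq_sq₀ (norm_nonneg _) (norm_nonneg _), norm_sq_eq_tsum, norm_sq_eq_tsum]
  rw [← hφ.tsum_eq]
  · simp [Finsupp.mapDomain_apply hφ]
  · intro s hs
    by_contra h
    exact hs (by simp [Finsupp.mapDomain_of_notMem_range x s h])

theorem norm_toL2_comapDomain_le {S S' : Type*} (φ : S → S') (hφ : Function.Injective φ)
    (x : S' →₀ ℂ) : ‖toL2 (Finsupp.comapDomain φ x hφ.injOn)‖ ≤ ‖toL2 x‖ := by
  rw [← sq_le_sq₀ (norm_nonneg _) (norm_nonneg _), norm_sq_eq_tsum, norm_sq_eq_tsum]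
  exact tsum_comp_le_tsum_of_inj (summable_norm_sq (toL2 x)) (fun _ => by positivity) hφ

/-- An equivariant map is bounded for the `ℓ²`-norms, if the source has finitely many orbits. -/
theorem exists_bound [Finite κ] (T : EquivariantMap G κ ι) :
    ∃ C : ℝ, ∀ c, ‖(toL2 ∘ₗ T.toLin) c‖ ≤ C * ‖toL2 c‖ := by
  classical
  cases nonempty_fintype κ
  have hk : ∀ k : κ, Function.Injective fun h : G => (h, k) := fun k a b hab => by
    simpa using hab
  have hp : ∀ p : G × ι, Function.Injective fun h : G => (h * p.1, p.2) := fun p a b hab => by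
    simpa using hab
  let R (k : κ) (p : G × ι) : (G × κ →₀ ℂ) →ₗ[ℂ] (G × ι →₀ ℂ) :=
    Finsupp.lmapDomain ℂ ℂ (fun h : G => (h * p.1, p.2)) ∘ₗ
      Finsupp.lcomapDomain (fun h : G => (h, k)) (hk k)
  have hR : ∀ k p c, ‖toL2 (R k p c)‖ ≤ ‖toL2 c‖ := fun k p c =>
    (norm_toL2_mapDomain _ (hp p) _).trans_le (norm_toL2_comapDomain_le _ (hk k) c)
  let a (k : κ) : G × ι →₀ ℂ := T.toLin (Finsupp.single (1, k) 1)
  have hT : T.toLin = ∑ k, ∑ p ∈ (a k).support, a k p • R k p := by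
    refine Finsupp.lhom_ext' fun q => LinearMap.ext_ring ?_
    obtain ⟨h, k⟩ := q
    have h1 : T.toLin (Finsupp.single (h, k) 1) = shift h (a k) := by
      rw [← T.map_shift']; simp
    have h2 : ∀ k' p, R k' p (Finsupp.single (h, k) 1) =
        if k' = k then Finsupp.single (h * p.1, p.2) 1 else 0 := by
      intro k' p
      have : Finsupp.comapDomain (fun h : G => (h, k')) (Finsupp.single (h, k) (1 : ℂ))
          (hk k').injOn = if k' = k then Finsupp.single h 1 else 0 := by
        ext y
        by_cases hkk : k' = k
        · subst hkk; simp [Finsupp.single_apply]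
        · simp [hkk, Ne.symm hkk, eq_comm]
      simp only [R, LinearMap.comp_apply, Finsupp.lmapDomain_apply, Finsupp.lcomapDomain]
      change Finsupp.mapDomain _ (Finsupp.comapDomain (fun h : G => (h, k'))
        (Finsupp.single (h, k) (1 : ℂ)) (hk k').injOn) = _
      rw [this]
      split_ifs <;> simp
    simp only [LinearMap.comp_apply, Finsupp.lsingle_apply, h1, LinearMap.sum_apply,
      LinearMap.smul_apply, h2, smul_ite, smul_zero]
    rw [Finset.sum_eq_single k (fun b _ hb => by simp [hb]) (by simp)]
    conv_lhs => rw [← Finsupp.sum_single (a k)]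
    simp [Finsupp.sum, map_sum]
  refine ⟨∑ k, ∑ p ∈ (a k).support, ‖a k p‖, fun c => ?_⟩
  rw [LinearMap.comp_apply, hT]
  simp only [LinearMap.sum_apply, LinearMap.smul_apply, map_sum, map_smul, Finset.sum_mul]
  refine norm_sum_le_of_le _ fun k _ => norm_sum_le_of_le _ fun p _ => ?_
  rw [norm_smul]
  exact mul_le_mul_of_nonneg_left (hR k p c) (norm_nonneg _)

theorem hat_toL2 [Finite κ] (T : EquivariantMap G κ ι) (c : G × κ →₀ ℂ) :
    T.hat (toL2 c) = toL2 (T.toLin c) :=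
  LinearMap.extendOfNorm_eq denseRange_toL2 T.exists_bound c

theorem hat_translate [Finite κ] (T : EquivariantMap G κ ι) (x : G) (f : Ell2 (G × κ)) :
    T.hat (translate x f) = translate x (T.hat f) := by
  refine denseRange_toL2.induction_on f (isClosed_eq ?_ ?_) fun c => ?_
  · exact T.hat.continuous.comp (translate x).continuous
  · exact (translate x).continuous.comp T.hat.continuous
  · rw [← toL2_shift, hat_toL2, hat_toL2, T.map_shift', toL2_shift]

/-- `ker T̂`, as a Hilbert module. -/
def kerHat [Finite κ] (T : EquivariantMap G κ ι) : HilbertSubmodule G κ where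
  carrier := LinearMap.ker T.hat.toLinearMap
  isClosed' := T.hat.isClosed_ker
  translate_mem' x f hf := by
    have hf' : T.hat f = 0 := hf
    change T.hat (translate x f) = 0
    rw [T.hat_translate, hf', map_zero]

/-- The closure of `im T̂`, as a Hilbert module. -/
def closureRangeHat [Finite κ] (T : EquivariantMap G κ ι) : HilbertSubmodule G ι :=
  HilbertSubmodule.closure (LinearMap.range T.hat.toLinearMap) <| by
    rintro x _ ⟨f, rfl⟩
    exact ⟨translate x f, T.hat_translate x f⟩

/-- The `ℓ²`-closure of the kernel of `T` on finitely supported chains, as a Hilbert module. -/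
def closureKer (T : EquivariantMap G κ ι) : HilbertSubmodule G κ :=
  HilbertSubmodule.closure ((LinearMap.ker T.toLin).map toL2) <| by
    rintro x _ ⟨c, hc, rfl⟩
    refine ⟨shift x c, ?_, toL2_shift x c⟩
    have hc' : T.toLin c = 0 := hc
    change T.toLin (shift x c) = 0
    rw [T.map_shift', hc', map_zero]

/-- The equivariant map with the given (equivariant) values on the cells. -/
def ofBasis (b : G × κ → (G × ι →₀ ℂ)) (hb : ∀ x p, b (x * p.1, p.2) = shift x (b p)) :
    EquivariantMap G κ ι where
  toLin := Finsupp.linearCombination ℂ b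
  map_shift' x c := by
    induction c using Finsupp.induction_linear with
    | zero => simp
    | add f g hf hg => simp [hf, hg]
    | single p a => simp [hb]

end EquivariantMap

/-- The reduced homology `ker B̂ / closure (im Â)` of `C --A--> D --B--> E`, as the orthogonal
complement of `closure (im Â)` in `ker B̂`. -/
def reducedHomology {G κ ι μ : Type*} [Group G] [Finite κ] [Finite ι]
    (A : EquivariantMap G κ ι) (B : EquivariantMap G ι μ) : HilbertSubmodule G ι :=
  B.kerHat.inf A.closureRangeHat.orthogonal

/-! ### The Cayley complex

For `g₁, …, gₙ` in `G`: the vertices are `(h, ())`, the edges are `(h, j)`, from `h` to `h gⱼ`.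
An edge loop is given by its base point `h` and a word `w` in the letters `gⱼ^{±1}` which
evaluates to `1`; one 2-cell `(h, w)` is glued along every edge loop with `w` nonempty. -/

section Cayley

variable {G : Type*} [Group G] {n : ℕ} (g : Fin n → G)

/-- The element of `G` denoted by a letter: `(j, true)` is `gⱼ` and `(j, false)` is `gⱼ⁻¹`. -/
def letter : Fin n × Bool → G
  | (j, true) => g j
  | (j, false) => (g j)⁻¹

/-- The nonempty words in `g₁^{±1}, …, gₙ^{±1}` that evaluate to `1`: the labels of the edge loops
of positive length. -/
def Relator : Type := {w : List (Fin n × Bool) // w ≠ [] ∧ (w.map (letter g)).prod = 1}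

/-- The 1-chain traversed by the edge path that starts at `h` and follows a word. -/
def pathChain : G → List (Fin n × Bool) → (G × Fin n →₀ ℂ)
  | _, [] => 0
  | h, (j, true) :: w => Finsupp.single (h, j) 1 + pathChain (h * g j) w
  | h, (j, false) :: w => -Finsupp.single (h * (g j)⁻¹, j) 1 + pathChain (h * (g j)⁻¹) w

theorem pathChain_mul (x h : G) (w : List (Fin n × Bool)) :
    pathChain g (x * h) w = shift x (pathChain g h w) := by
  induction w generalizing h with
  | nil => simp [pathChain]
  | cons a w ih =>
    obtain ⟨j, b⟩ := a
    cases b <;> simp [pathChain, ← ih, mul_assoc]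

/-- `∂₀ = 0`. -/
def boundary₀ : EquivariantMap G Unit Empty where
  toLin := 0
  map_shift' _ _ := by simp

/-- `∂₁ (h, j) = h gⱼ - h`. -/
def boundary₁ : EquivariantMap G (Fin n) Unit :=
  .ofBasis (fun p => Finsupp.single (p.1 * g p.2, ()) 1 - Finsupp.single (p.1, ()) 1) <| by
    intro x p
    simp [mul_assoc]

/-- `∂₂` on the cofinite subcomplex `X_F` that consists of the Cayley graph and the `G`-translates
of the 2-cells with labels in the finite set `F`. -/
def boundary₂ (F : Finset (Relator g)) : EquivariantMap G F (Fin n) :=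
  .ofBasis (fun p => pathChain g p.1 p.2.1.1) fun x p => pathChain_mul g x p.1 _

/-- `β₀(G) = dim H₀⁽²⁾(X)`; the 1-skeleton of `X` is cofinite. -/
def betti₀ : ℝ := (reducedHomology (boundary₁ g) boundary₀).dim

/-- `β₁(G)`, as the Cheeger–Gromov limit along the exhaustion of `X` by the cofinite subcomplexes
`X_F`: the supremum over `F` of the infimum over `F' ⊇ F` of the dimension of
`ker ∂̂₁ / closure (im (∂̂₂ on X_{F'}))`. (All the `X_F` have the same 1-cells, so `∂̂₁` does not
depend on `F`, and no intersection with the 1-chains of `X_F` is needed.) -/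
def betti₁ : ℝ :=
  ⨆ F : Finset (Relator g), ⨅ F' : {F' : Finset (Relator g) // F ⊆ F'},
    (reducedHomology (boundary₂ g F'.1) (boundary₁ g)).dim

/-- The coboundary `δf` of a function on the vertices: `δf (h, j) = f (h gⱼ) - f h`. -/
def coboundary (f : G → ℂ) : G × Fin n → ℂ := fun p => f (p.1 * g p.2) - f p.1

/-- The square-summable 1-cochains of the form `δf` with `f` bounded. -/
def boundedCoboundaries : Submodule ℂ (Ell2 (G × Fin n)) where
  carrier := {c | ∃ f : G → ℂ, Memℓp f ∞ ∧ (c : G × Fin n → ℂ) = coboundary g f}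
  zero_mem' := ⟨0, zero_memℓp, by ext p; simp [coboundary]⟩
  add_mem' := by
    rintro c d ⟨f, hf, hc⟩ ⟨f', hf', hd⟩
    refine ⟨f + f', hf.add hf', ?_⟩
    ext p
    simp only [lp.coeFn_add, hc, hd, coboundary, Pi.add_apply]
    ring
  smul_mem' := by
    rintro a c ⟨f, hf, hc⟩
    refine ⟨a • f, hf.const_smul a, ?_⟩
    ext p
    simp only [lp.coeFn_smul, hc, coboundary, Pi.smul_apply, smul_eq_mul]
    ring

/-- The `ℓ²`-closure of the square-summable coboundaries of bounded functions, as a Hilbert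
module. -/
def closureBoundedCoboundaries : HilbertSubmodule G (Fin n) :=
  HilbertSubmodule.closure (boundedCoboundaries g) <| by
    rintro x c ⟨f, hf, hc⟩
    refine ⟨fun h => f (x⁻¹ * h), ?_, ?_⟩
    · refine memℓp_infty ?_
      obtain ⟨C, hC⟩ := hf.bddAbove
      exact ⟨C, by rintro _ ⟨h, rfl⟩; exact hC ⟨x⁻¹ * h, rfl⟩⟩
    · ext p
      rw [translate_apply, hc]
      simp [coboundary, mul_assoc]

end Cayley

end L2Betti

end

namespace L2Betti

open Filter Topology

/-! ### Elementary properties of the von Neumann dimension -/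

/-! Let `R` be the closure of the image of `∂̂₁`, and `Z` the closure of the finitely supported
1-cycles. Then `β₀ = 1 - dim R` (`betti₀_eq`). Since the 2-cells span all finite cycles
(`ker_boundary₁`), the closed images of `∂̂₂` on the `X_F` increase to a dense subspace of `Z`.
Dimension is continuous along such unions (`HilbertSubmodule.tendsto_dim`), so `β₁ = dim ker ∂̂₁ -
dim Z` (`betti₁_eq`). The rank theorem `dim ker ∂̂₁ + dim R = n` gives the first equality.

For the second, `n - dim Z` is the dimension of the orthogonal complement of `Z`. A square-summable
cochain orthogonal to all finite cycles is `δf`, with `f` its integral along paths from `1`.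
Clipping `f` approximates it by coboundaries of bounded functions
(`mem_closure_boundedCoboundaries`).

The rank theorem rests on the trace property: for a contraction `T`, the traces of `(1 - TT*)^k` and
`(1 - T*T)^k` differ by a constant independent of `k`, and by the mean ergodic theorem the averages
over `k` converge to the projections onto `ker T*` and `ker T`. -/

theorem inner_toL2_single {S : Type*} (s : S) (f : Ell2 S) :
    ⟪toL2 (Finsupp.single s 1), f⟫_ℂ = f s := by
  classical
  have h : toL2 (Finsupp.single s (1 : ℂ)) = lp.single 2 s (1 : ℂ) := by
    ext j
    rw [toL2_apply, lp.single_apply, Finsupp.single_apply]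
    by_cases h : s = j
    · subst h; simp
    · rw [if_neg h, Pi.single_eq_of_ne (Ne.symm h)]
  rw [h, lp.inner_single_left]
  simp

theorem translate_toL2_single {G ι : Type*} [Group G] (x : G) (p : G × ι) :
    translate x (toL2 (Finsupp.single p 1)) = toL2 (Finsupp.single (x * p.1, p.2) 1) := by
  rw [← toL2_shift, shift_single]

namespace HilbertSubmodule

variable {G ι κ : Type*} [Group G]

instance (V : HilbertSubmodule G ι) : CompleteSpace V.carrier := V.isClosed'.completeSpace_coe

theorem dim_congr [Fintype ι] {V W : HilbertSubmodule G ι} (h : V.carrier = W.carrier) :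
    V.dim = W.dim := by
  cases V; cases W; cases h; rfl

theorem dim_nonneg [Fintype ι] (V : HilbertSubmodule G ι) : 0 ≤ V.dim :=
  Finset.sum_nonneg fun _ _ => by
    rw [proj, ← V.carrier.inner_starProjection_left_eq_right]
    exact V.carrier.re_inner_starProjection_nonneg _

/-- For nested subspaces the difference of the two projections is the projection onto the relative
complement. -/
theorem dim_inf_orthogonal [Fintype ι] {V W : HilbertSubmodule G ι} (h : W.carrier ≤ V.carrier) :
    (V.inf W.orthogonal).dim = V.dim - W.dim := by
  rw [dim, dim, dim, ← Finset.sum_sub_distrib]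
  refine Finset.sum_congr rfl fun i _ => ?_
  rw [← map_sub, ← inner_sub_right]
  congr 2
  generalize toL2 (Finsupp.single ((1 : G), i) (1 : ℂ)) = u
  have hV := V.carrier.sub_starProjection_mem_orthogonal u
  have hW := W.carrier.sub_starProjection_mem_orthogonal u
  have hd : V.proj u - W.proj u = (u - W.proj u) - (u - V.proj u) := by abel
  refine Submodule.eq_starProjection_of_mem_orthogonal ⟨?_, ?_⟩ ?_
  · exact V.carrier.sub_mem (Submodule.starProjection_apply_mem _ _)
      (h (Submodule.starProjection_apply_mem _ _))
  · rw [hd]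
    exact Submodule.sub_mem _ hW (Submodule.orthogonal_le h hV)
  · have he : u - (V.proj u - W.proj u) = (u - V.proj u) + W.proj u := by abel
    rw [he]
    refine Submodule.add_mem _ (Submodule.orthogonal_le inf_le_left hV) ?_
    exact Submodule.orthogonal_le (show (V.inf W.orthogonal).carrier ≤ W.carrierᗮ from inf_le_right)
      (W.carrier.le_orthogonal_orthogonal (Submodule.starProjection_apply_mem _ _))

theorem dim_orthogonal [Fintype ι] (V : HilbertSubmodule G ι) :
    V.orthogonal.dim = Fintype.card ι - V.dim := by
  rw [dim, dim, eq_sub_iff_add_eq, ← Finset.sum_add_distrib, Fintype.card_eq_sum_ones,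
    Nat.cast_sum]
  refine Finset.sum_congr rfl fun i _ => ?_
  rw [← map_add, ← inner_add_right]
  have h : V.orthogonal.proj (toL2 (Finsupp.single ((1 : G), i) 1)) +
      V.proj (toL2 (Finsupp.single ((1 : G), i) 1)) = toL2 (Finsupp.single ((1 : G), i) 1) := by
    rw [add_comm]
    exact V.carrier.starProjection_add_starProjection_orthogonal _
  rw [h, inner_toL2_single]
  simp

end HilbertSubmodule

/-! ### The trace and the rank theorem -/

section Trace

variable {G ι κ : Type*} [Group G]

/-- Bounded operators commuting with the left translations. -/
def IsEquivariant (A : Ell2 (G × κ) →L[ℂ] Ell2 (G × ι)) : Prop :=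
  ∀ x f, A (translate x f) = translate x (A f)

/-- The von Neumann trace of a bounded operator on `ℓ²(G × ι)`. -/
noncomputable def vnTrace [Fintype ι] (A : Ell2 (G × ι) →L[ℂ] Ell2 (G × ι)) : ℂ :=
  ∑ i : ι, ⟪toL2 (Finsupp.single ((1 : G), i) 1), A (toL2 (Finsupp.single ((1 : G), i) 1))⟫_ℂ

theorem vnTrace_sub [Fintype ι] (A B : Ell2 (G × ι) →L[ℂ] Ell2 (G × ι)) :
    vnTrace (A - B) = vnTrace A - vnTrace B := by
  simp [vnTrace]

theorem vnTrace_one [Fintype ι] :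
    vnTrace (1 : Ell2 (G × ι) →L[ℂ] Ell2 (G × ι)) = Fintype.card ι := by
  simp only [vnTrace, inner_toL2_single]
  simp

theorem IsEquivariant.comp {μ : Type*} {A : Ell2 (G × κ) →L[ℂ] Ell2 (G × ι)}
    {B : Ell2 (G × μ) →L[ℂ] Ell2 (G × κ)} (hA : IsEquivariant A) (hB : IsEquivariant B) :
    IsEquivariant (A ∘L B) := fun x f => by
  simp [hA x, hB x]

theorem IsEquivariant.one : IsEquivariant (1 : Ell2 (G × ι) →L[ℂ] Ell2 (G × ι)) :=
  fun _ _ => rfl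

theorem IsEquivariant.sub {A B : Ell2 (G × κ) →L[ℂ] Ell2 (G × ι)}
    (hA : IsEquivariant A) (hB : IsEquivariant B) : IsEquivariant (A - B) := fun x f => by
  simp [hA x, hB x]

theorem IsEquivariant.pow {A : Ell2 (G × ι) →L[ℂ] Ell2 (G × ι)} (hA : IsEquivariant A) (k : ℕ) :
    IsEquivariant (A ^ k) := by
  induction k with
  | zero => exact .one
  | succ k ih => rw [pow_succ]; exact ih.comp hA

theorem IsEquivariant.adjoint {A : Ell2 (G × κ) →L[ℂ] Ell2 (G × ι)} (hA : IsEquivariant A) :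
    IsEquivariant (ContinuousLinearMap.adjoint A) := fun x f => by
  refine ext_inner_left ℂ fun v => ?_
  rw [ContinuousLinearMap.adjoint_inner_right, inner_translate, inner_translate, ← hA,
    ContinuousLinearMap.adjoint_inner_right]

/-- Expand `⟨A* e, B e⟩` in coordinates; equivariance of `A` moves the translation by `h` to the
other side, whence `h⁻¹`. -/
theorem vnTrace_comp [Fintype ι] [Fintype κ] {A : Ell2 (G × κ) →L[ℂ] Ell2 (G × ι)}
    (hA : IsEquivariant A) (B : Ell2 (G × ι) →L[ℂ] Ell2 (G × κ)) :
    vnTrace (A ∘L B) = ∑ i : ι, ∑ k : κ, ∑' h : G,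
      A (toL2 (Finsupp.single ((1 : G), k) 1)) (h⁻¹, i) *
        B (toL2 (Finsupp.single ((1 : G), i) 1)) (h, k) := by
  refine Finset.sum_congr rfl fun i _ => ?_
  rw [ContinuousLinearMap.comp_apply, ← ContinuousLinearMap.adjoint_inner_left]
  have hs := lp.hasSum_inner (𝕜 := ℂ)
    (ContinuousLinearMap.adjoint A (toL2 (Finsupp.single ((1 : G), i) 1)))
    (B (toL2 (Finsupp.single ((1 : G), i) 1)))
  have hc : ∀ p : G × κ,
      ⟪ContinuousLinearMap.adjoint A (toL2 (Finsupp.single ((1 : G), i) 1)) p,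
        B (toL2 (Finsupp.single ((1 : G), i) 1)) p⟫_ℂ =
      A (toL2 (Finsupp.single ((1 : G), p.2) 1)) (p.1⁻¹, i) *
        B (toL2 (Finsupp.single ((1 : G), i) 1)) p := by
    rintro ⟨h, k⟩
    have h1 : toL2 (Finsupp.single (h, k) (1 : ℂ)) =
        translate h (toL2 (Finsupp.single ((1 : G), k) 1)) := by
      rw [translate_toL2_single, mul_one]
    rw [RCLike.inner_apply, mul_comm, ← inner_toL2_single (h, k), inner_conj_symm,
      ContinuousLinearMap.adjoint_inner_left, h1, hA, inner_toL2_single, translate_apply, mul_one]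
  simp_rw [hc] at hs
  exact hs.tsum_eq.symm.trans <| ((Equiv.prodComm κ G).tsum_eq _).symm.trans <|
    ((Equiv.prodComm κ G).summable_iff.2 hs.summable).tsum_prod.trans (tsum_fintype _)

/-- The coordinate formula is symmetric under `h ↦ h⁻¹`. -/
theorem vnTrace_comp_comm [Fintype ι] [Fintype κ] {A : Ell2 (G × κ) →L[ℂ] Ell2 (G × ι)}
    {B : Ell2 (G × ι) →L[ℂ] Ell2 (G × κ)} (hA : IsEquivariant A) (hB : IsEquivariant B) :
    vnTrace (A ∘L B) = vnTrace (B ∘L A) := by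
  rw [vnTrace_comp hA, vnTrace_comp hB, Finset.sum_comm]
  refine Finset.sum_congr rfl fun k _ => Finset.sum_congr rfl fun i _ => ?_
  rw [← (Equiv.inv G).tsum_eq]
  simp [mul_comm]

-- Raising `k` by one subtracts the traces of `S T*` and `T* S`, where `S = (1 - TT*)^k T`. These
-- agree by the trace property, so the difference keeps its value at `k = 0`.
open ContinuousLinearMap in
theorem vnTrace_one_sub_pow [Fintype ι] [Fintype κ] {T : Ell2 (G × κ) →L[ℂ] Ell2 (G × ι)}
    (hT : IsEquivariant T) (k : ℕ) :
    vnTrace ((1 - T ∘L adjoint T) ^ k) - vnTrace ((1 - adjoint T ∘L T) ^ k) =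
      Fintype.card ι - Fintype.card κ := by
  induction k with
  | zero => simp only [pow_zero, vnTrace_one]
  | succ k ih =>
    have hc : ∀ m : ℕ, ((1 - T ∘L adjoint T) ^ m) ∘L T = T ∘L ((1 - adjoint T ∘L T) ^ m) := by
      intro m
      induction m with
      | zero => rfl
      | succ m ihm =>
        have h1 : (1 - T ∘L adjoint T) ∘L T = T ∘L (1 - adjoint T ∘L T) := by
          ext1 v; simp
        rw [pow_succ, pow_succ', mul_def, mul_def, comp_assoc, h1, ← comp_assoc, ihm, comp_assoc,
          ← mul_def, ← mul_def, ← pow_succ, ← pow_succ']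
    have hl : (1 - T ∘L adjoint T) ^ (k + 1) =
        (1 - T ∘L adjoint T) ^ k - (((1 - T ∘L adjoint T) ^ k) ∘L T) ∘L adjoint T := by
      rw [pow_succ, mul_sub, mul_one, mul_def, comp_assoc]
    have hr : (1 - adjoint T ∘L T) ^ (k + 1) =
        (1 - adjoint T ∘L T) ^ k - adjoint T ∘L (((1 - T ∘L adjoint T) ^ k) ∘L T) := by
      rw [pow_succ', sub_mul, one_mul, mul_def, comp_assoc, hc]
    rw [hl, hr, vnTrace_sub, vnTrace_sub, vnTrace_comp_comm (B := adjoint T) _ hT.adjoint]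
    · rw [← ih]; ring
    · exact ((IsEquivariant.one.sub (hT.comp hT.adjoint)).pow k).comp hT

-- `‖x - TT*x‖² = ‖x‖² - 2‖T*x‖² + ‖TT*x‖²`, and the last term is at most `‖T*x‖²`.
open ContinuousLinearMap in
theorem norm_one_sub_comp_adjoint_le {E F : Type*} [NormedAddCommGroup E] [InnerProductSpace ℂ E]
    [CompleteSpace E] [NormedAddCommGroup F] [InnerProductSpace ℂ F] [CompleteSpace F]
    (T : E →L[ℂ] F) (hT : ‖T‖ ≤ 1) : ‖1 - T ∘L adjoint T‖ ≤ 1 := by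
  refine opNorm_le_bound _ zero_le_one fun x => ?_
  rw [one_mul, ← sq_le_sq₀ (norm_nonneg _) (norm_nonneg _)]
  change ‖x - T (adjoint T x)‖ ^ 2 ≤ _
  have h1 : ‖T (adjoint T x)‖ ≤ ‖adjoint T x‖ := T.le_of_opNorm_le hT _ |>.trans_eq (one_mul _)
  have h2 : RCLike.re ⟪x, T (adjoint T x)⟫_ℂ = ‖adjoint T x‖ ^ 2 := by
    rw [← adjoint_inner_left, inner_self_eq_norm_sq]
  rw [norm_sub_sq (𝕜 := ℂ), h2]
  nlinarith [norm_nonneg (T (adjoint T x)), norm_nonneg (adjoint T x)]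

-- Von Neumann's mean ergodic theorem, tested on the finitely many basis vectors that compute the
-- trace.
open ContinuousLinearMap in
theorem tendsto_average_vnTrace [Fintype ι] (V : HilbertSubmodule G ι)
    (f : Ell2 (G × ι) →L[ℂ] Ell2 (G × ι)) (hf : ‖f‖ ≤ 1) (hV : ∀ v, v ∈ V.carrier ↔ f v = v) :
    Tendsto (fun N : ℕ => (N : ℂ)⁻¹ * ∑ k ∈ Finset.range N, vnTrace (f ^ k)) atTop
      (𝓝 (vnTrace V.proj)) := by
  have hE : ((f : Ell2 (G × ι) →ₗ[ℂ] Ell2 (G × ι)).eqLocus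
      ((1 : Ell2 (G × ι) →L[ℂ] Ell2 (G × ι)) : Ell2 (G × ι) →ₗ[ℂ] Ell2 (G × ι))) = V.carrier := by
    ext v
    exact (hV v).symm
  have ht : ∀ v, Tendsto (fun N => birkhoffAverage ℂ f _root_.id N v) atTop (𝓝 (V.proj v)) := by
    intro v
    have h := tendsto_birkhoffAverage_orthogonalProjection f hf v
    have hK : ∀ (K : Submodule ℂ (Ell2 (G × ι))) [K.HasOrthogonalProjection], K = V.carrier →
        (K.orthogonalProjectionOnto v : Ell2 (G × ι)) = V.proj v := by
      rintro K _ rfl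
      rfl
    rwa [hK _ hE] at h
  have h := tendsto_finsetSum Finset.univ fun (i : ι) _ =>
    (tendsto_const_nhds (x := toL2 (Finsupp.single ((1 : G), i) (1 : ℂ)))).inner (𝕜 := ℂ)
      (ht (toL2 (Finsupp.single ((1 : G), i) (1 : ℂ))))
  refine h.congr fun N => ?_
  simp only [birkhoffAverage, birkhoffSum, inner_smul_right, inner_sum, vnTrace, id, FunLike.coe_pow_eq_iterate]
  rw [← Finset.mul_sum, Finset.sum_comm]

-- The fixed vectors of `1 - TT*` and `1 - T*T` are `ker T*` and `ker T`.
open ContinuousLinearMap in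
theorem vnTrace_proj_sub_vnTrace_proj [Fintype ι] [Fintype κ]
    {T : Ell2 (G × κ) →L[ℂ] Ell2 (G × ι)} (hT : IsEquivariant T) (hn : ‖T‖ ≤ 1)
    (V : HilbertSubmodule G ι) (W : HilbertSubmodule G κ)
    (hV : ∀ v, v ∈ V.carrier ↔ adjoint T v = 0) (hW : ∀ w, w ∈ W.carrier ↔ T w = 0) :
    vnTrace V.proj - vnTrace W.proj = Fintype.card ι - Fintype.card κ := by
  have h1 := tendsto_average_vnTrace V (1 - T ∘L adjoint T) (norm_one_sub_comp_adjoint_le T hn) <| by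
    intro v
    rw [hV, sub_apply, one_apply_eq_self, sub_eq_self, comp_apply]
    refine ⟨fun h => by rw [h, map_zero], fun h => ?_⟩
    rw [← inner_self_eq_zero (𝕜 := ℂ), adjoint_inner_left, h, inner_zero_right]
  have h2 := tendsto_average_vnTrace W (1 - adjoint T ∘L T) (by
      simpa using norm_one_sub_comp_adjoint_le (adjoint T) (by simpa using hn)) <| by
    intro v
    rw [hW, sub_apply, one_apply_eq_self, sub_eq_self, comp_apply]
    refine ⟨fun h => by rw [h, map_zero], fun h => ?_⟩
    rw [← inner_self_eq_zero (𝕜 := ℂ), ← adjoint_inner_left, h, inner_zero_left]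
  refine tendsto_nhds_unique (h1.sub h2) (tendsto_const_nhds.congr' ?_)
  -- The average over an empty range is `0`, so `N = 0` is excluded.
  filter_upwards [eventually_ne_atTop 0] with N hN
  rw [← mul_sub, ← Finset.sum_sub_distrib]
  simp_rw [vnTrace_one_sub_pow hT]
  rw [Finset.sum_const, Finset.card_range, nsmul_eq_mul, inv_mul_cancel_left₀]
  exact_mod_cast hN

theorem HilbertSubmodule.dim_eq_re_vnTrace [Fintype ι] (V : HilbertSubmodule G ι) :
    V.dim = (vnTrace V.proj).re := by
  simp [dim, vnTrace]

open ContinuousLinearMap in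
/-- The rank theorem: `dim ker T̂ + dim (closure (im T̂)) = |κ|`. -/
theorem EquivariantMap.dim_kerHat_add_dim_closureRangeHat [Fintype ι] [Fintype κ]
    (T : EquivariantMap G κ ι) :
    T.kerHat.dim + T.closureRangeHat.dim = Fintype.card κ := by
  -- Rescaling to a contraction changes neither kernel nor range; the summand `1` keeps the scalar
  -- finite and nonzero when `T.hat = 0`.
  set a : ℂ := ((1 + ‖T.hat‖ : ℝ) : ℂ)⁻¹ with ha
  have hpos : 0 < 1 + ‖T.hat‖ := by positivity
  have ha0 : a ≠ 0 := inv_ne_zero (by exact_mod_cast hpos.ne')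
  have hn : ‖a • T.hat‖ ≤ 1 := by
    rw [norm_smul, ha, norm_inv, Complex.norm_real, Real.norm_of_nonneg hpos.le,
      inv_mul_le_one₀ hpos]
    linarith
  have h := vnTrace_proj_sub_vnTrace_proj (T := a • T.hat)
    (fun x f => by simp [T.hat_translate]) hn T.closureRangeHat.orthogonal T.kerHat
    (fun v => by
      change v ∈ (Submodule.topologicalClosure _)ᗮ ↔ _
      rw [Submodule.orthogonal_closure]
      change _ ↔ v ∈ LinearMap.ker (adjoint (a • T.hat)).toLinearMap
      rw [← orthogonal_range, toLinearMap_smul, LinearMap.range_smul _ _ ha0])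
    (fun w => by
      change T.hat w = 0 ↔ a • T.hat w = 0
      simp [ha0])
  have h' := congrArg Complex.re h
  rw [Complex.sub_re, ← HilbertSubmodule.dim_eq_re_vnTrace, ← HilbertSubmodule.dim_eq_re_vnTrace,
    HilbertSubmodule.dim_orthogonal, Complex.sub_re, Complex.natCast_re, Complex.natCast_re] at h'
  linarith

end Trace

end L2Betti

/-! ### Density of finite chains and continuity of dimension -/

namespace L2Betti

open Filter Topology

/-- By density and continuity, closed images are determined by finitely supported chains, where the
topology of `X` is pure algebra. -/
theorem EquivariantMap.closureRangeHat_carrier {G ι κ : Type*} [Group G] [Finite κ]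
    (T : EquivariantMap G κ ι) :
    T.closureRangeHat.carrier = ((LinearMap.range T.toLin).map toL2).topologicalClosure := by
  refine le_antisymm ?_ ?_
  · refine Submodule.topologicalClosure_minimal _ ?_ (Submodule.isClosed_topologicalClosure _)
    rintro _ ⟨f, rfl⟩
    refine denseRange_toL2.induction_on f
      ((Submodule.isClosed_topologicalClosure _).preimage T.hat.continuous) fun c => ?_
    refine Submodule.le_topologicalClosure _ ?_
    change T.hat (toL2 c) ∈ _
    rw [T.hat_toL2]
    exact ⟨_, ⟨c, rfl⟩, rfl⟩
  · refine Submodule.topologicalClosure_mono ?_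
    rintro _ ⟨_, ⟨c, rfl⟩, rfl⟩
    exact ⟨toL2 c, T.hat_toL2 c⟩

/-- The dimension is continuous along increasing unions. -/
theorem HilbertSubmodule.tendsto_dim {G ι α : Type*} [Group G] [Fintype ι] [Preorder α]
    (V : α → HilbertSubmodule G ι) (hV : Monotone fun a => (V a).carrier)
    (W : HilbertSubmodule G ι) (hW : W.carrier = (⨆ a, (V a).carrier).topologicalClosure) :
    Tendsto (fun a => (V a).dim) atTop (𝓝 W.dim) := by
  refine tendsto_finsetSum _ fun i _ => ?_
  refine (RCLike.continuous_re.tendsto _).comp (tendsto_const_nhds.inner (𝕜 := ℂ) ?_)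
  -- Projections onto an increasing family converge strongly, and `dim` is a finite sum of matrix
  -- coefficients.
  have h := Submodule.starProjection_tendsto_closure_iSup (fun a => (V a).carrier) hV
    (toL2 (Finsupp.single ((1 : G), i) 1))
  have hK : ∀ (K : Submodule ℂ (Ell2 (G × ι))) [K.HasOrthogonalProjection], W.carrier = K →
      ∀ v, K.starProjection v = W.proj v := by
    rintro K _ rfl v
    rfl
  rwa [hK _ hW] at h

/-! ### Finite 1-cycles of the Cayley graph and the 2-cells -/

section Cayley

variable {G : Type*} [Group G] {n : ℕ} (g : Fin n → G)

theorem pathChain_append (h : G) (v w : List (Fin n × Bool)) :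
    pathChain g h (v ++ w) =
      pathChain g h v + pathChain g (h * (v.map (letter g)).prod) w := by
  induction v generalizing h with
  | nil => simp [pathChain]
  | cons a v ih =>
    obtain ⟨j, b⟩ := a
    cases b <;> simp [pathChain, letter, ih, mul_assoc, add_assoc]

theorem boundary₁_single (p : G × Fin n) :
    (boundary₁ g).toLin (Finsupp.single p 1) =
      Finsupp.single (p.1 * g p.2, ()) 1 - Finsupp.single (p.1, ()) 1 := by
  simp [boundary₁, EquivariantMap.ofBasis]

theorem boundary₁_pathChain (h : G) (w : List (Fin n × Bool)) :
    (boundary₁ g).toLin (pathChain g h w) =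
      Finsupp.single (h * (w.map (letter g)).prod, ()) 1 - Finsupp.single (h, ()) 1 := by
  induction w generalizing h with
  | nil => simp [pathChain]
  | cons a w ih =>
    obtain ⟨j, b⟩ := a
    cases b <;> simp [pathChain, letter, ih, boundary₁_single, mul_assoc]

variable {g}

theorem exists_word (hg : Subgroup.closure (Set.range g) = ⊤) (h : G) :
    ∃ w : List (Fin n × Bool), (w.map (letter g)).prod = h := by
  have hh : h ∈ Subgroup.closure (Set.range g) := hg ▸ Subgroup.mem_top h
  induction hh using Subgroup.closure_induction_left with
  | one => exact ⟨[], rfl⟩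
  | mul_left x hx y _ ih =>
    obtain ⟨j, rfl⟩ := hx
    obtain ⟨w, rfl⟩ := ih
    exact ⟨(j, true) :: w, rfl⟩
  | inv_mul_cancel x hx y _ ih =>
    obtain ⟨j, rfl⟩ := hx
    obtain ⟨w, rfl⟩ := ih
    exact ⟨(j, false) :: w, rfl⟩

/-- A choice of a 1-chain with boundary `h - 1` for every vertex `h`. -/
theorem exists_cone (hg : Subgroup.closure (Set.range g) = ⊤) :
    ∃ k : G → (G × Fin n →₀ ℂ),
      (∀ h, (boundary₁ g).toLin (k h) = Finsupp.single (h, ()) 1 - Finsupp.single (1, ()) 1) ∧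
      ∀ p : G × Fin n, Finsupp.single p 1 + k p.1 - k (p.1 * g p.2) ∈
        Submodule.span ℂ (Set.range fun q : G × Relator g => pathChain g q.1 q.2.1) := by
  choose w hw using exists_word hg
  set L := Submodule.span ℂ (Set.range fun q : G × Relator g => pathChain g q.1 q.2.1) with hL
  have hloop : ∀ h v, (v.map (letter g)).prod = 1 → pathChain g h v ∈ L := by
    intro h v hv
    by_cases hnil : v = []
    · subst hnil; exact L.zero_mem
    · exact Submodule.subset_span ⟨(h, ⟨v, hnil, hv⟩), rfl⟩
  refine ⟨fun h => pathChain g 1 (w h), fun h => ?_, fun p => ?_⟩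
  · rw [boundary₁_pathChain, hw, one_mul]
  · obtain ⟨h, j⟩ := p
    -- Both loops return to `1` along the same word, chosen for the element `(h * g j)⁻¹`; in the
    -- difference this return path cancels.
    have h1 := hloop 1 (w h ++ (j, true) :: w (h * g j)⁻¹) (by simp [hw, letter])
    have h2 := hloop 1 (w (h * g j) ++ w (h * g j)⁻¹) (by simp [hw])
    have h3 := L.sub_mem h1 h2
    rw [pathChain_append, pathChain_append, hw, hw, one_mul, one_mul, pathChain] at h3
    convert h3 using 1
    abel

/-- The 2-cells kill all finitely supported 1-cycles. -/
theorem ker_boundary₁ (hg : Subgroup.closure (Set.range g) = ⊤) :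
    LinearMap.ker (boundary₁ g).toLin =
      Submodule.span ℂ (Set.range fun q : G × Relator g => pathChain g q.1 q.2.1) := by
  refine le_antisymm (fun c hc => ?_) (Submodule.span_le.2 ?_)
  · obtain ⟨k, -, hk⟩ := exists_cone hg
    set L := Submodule.span ℂ (Set.range fun q : G × Relator g => pathChain g q.1 q.2.1)
    -- Coning off is a homotopy modulo `L`: `c - K ∂₁ c` lies in `L` for every chain, by a check on
    -- edges, and the correction vanishes on cycles.
    let K : (G × Unit →₀ ℂ) →ₗ[ℂ] (G × Fin n →₀ ℂ) := Finsupp.linearCombination ℂ fun p => k p.1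
    have h : ∀ c, c - K ((boundary₁ g).toLin c) ∈ L := by
      intro c
      induction c using Finsupp.induction_linear with
      | zero => simp
      | add f f' hf hf' =>
        rw [map_add, map_add, add_sub_add_comm]
        exact L.add_mem hf hf'
      | single p a =>
        have hp : Finsupp.single p a = a • Finsupp.single p 1 := by simp
        rw [hp, map_smul, map_smul, ← smul_sub]
        refine L.smul_mem _ ?_
        convert hk p using 1
        simp only [boundary₁_single, map_sub, K, Finsupp.linearCombination_single, one_smul]
        abel
    have hc' : (boundary₁ g).toLin c = 0 := hc
    simpa [hc'] using h c
  · rintro _ ⟨⟨h, w, -, hw⟩, rfl⟩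
    change (boundary₁ g).toLin (pathChain g h w) = 0
    rw [boundary₁_pathChain, hw, mul_one, sub_self]

theorem range_boundary₂ (F : Finset (Relator g)) :
    LinearMap.range (boundary₂ g F).toLin =
      Submodule.span ℂ (Set.range fun q : G × F => pathChain g q.1 q.2.1.1) :=
  Finsupp.range_linearCombination _

variable (g) in
theorem monotone_range_boundary₂ :
    Monotone fun F : Finset (Relator g) => LinearMap.range (boundary₂ g F).toLin := by
  intro F F' h
  simp only [range_boundary₂]
  refine Submodule.span_mono ?_
  rintro _ ⟨⟨x, r⟩, rfl⟩
  exact ⟨(x, ⟨r.1, h r.2⟩), rfl⟩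

theorem iSup_range_boundary₂ (hg : Subgroup.closure (Set.range g) = ⊤) :
    ⨆ F : Finset (Relator g), LinearMap.range (boundary₂ g F).toLin =
      LinearMap.ker (boundary₁ g).toLin := by
  simp only [range_boundary₂, ker_boundary₁ hg, ← Submodule.span_iUnion]
  congr 1
  ext c
  simp only [Set.mem_iUnion, Set.mem_range]
  constructor
  · rintro ⟨F, ⟨x, r⟩, rfl⟩
    exact ⟨(x, r.1), rfl⟩
  · rintro ⟨⟨x, r⟩, rfl⟩
    exact ⟨{r}, (x, ⟨r, Finset.mem_singleton_self r⟩), rfl⟩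

theorem monotone_closureRangeHat_boundary₂ :
    Monotone fun F : Finset (Relator g) => (boundary₂ g F).closureRangeHat.carrier := by
  intro F F' h
  simp only [EquivariantMap.closureRangeHat_carrier]
  exact Submodule.topologicalClosure_mono (Submodule.map_mono (monotone_range_boundary₂ g h))

/-- The finite cycles are the supremum of the algebraic images, and closing each image first does
not change the closure of the supremum. -/
theorem closureKer_boundary₁_carrier (hg : Subgroup.closure (Set.range g) = ⊤) :
    (boundary₁ g).closureKer.carrier =
      (⨆ F : Finset (Relator g), (boundary₂ g F).closureRangeHat.carrier).topologicalClosure := by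
  change Submodule.topologicalClosure _ = _
  rw [← iSup_range_boundary₂ hg, Submodule.map_iSup]
  refine le_antisymm (Submodule.topologicalClosure_mono (iSup_mono fun F => ?_))
    (Submodule.topologicalClosure_minimal _ (iSup_le fun F => ?_)
      (Submodule.isClosed_topologicalClosure _))
  · rw [EquivariantMap.closureRangeHat_carrier]
    exact Submodule.le_topologicalClosure _
  · rw [EquivariantMap.closureRangeHat_carrier]
    exact Submodule.topologicalClosure_mono
      (le_iSup (fun F : Finset (Relator g) => (LinearMap.range (boundary₂ g F).toLin).map toL2) F)

/-! ### The two Betti numbers in terms of `∂₁` -/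

variable (g) in
theorem closureKer_le_kerHat : (boundary₁ g).closureKer.carrier ≤ (boundary₁ g).kerHat.carrier := by
  refine Submodule.topologicalClosure_minimal _ ?_ (boundary₁ g).kerHat.isClosed'
  rintro _ ⟨c, hc, rfl⟩
  have hc' : (boundary₁ g).toLin c = 0 := hc
  change (boundary₁ g).hat (toL2 c) = 0
  rw [EquivariantMap.hat_toL2, hc', map_zero]

/-- The dimensions decrease along `F`, so each inner infimum is already the limit and the supremum
is over a constant. -/
theorem betti₁_eq (hg : Subgroup.closure (Set.range g) = ⊤) :
    betti₁ g = (boundary₁ g).kerHat.dim - (boundary₁ g).closureKer.dim := by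
  classical
  set d : Finset (Relator g) → ℝ :=
    fun F => (reducedHomology (boundary₂ g F) (boundary₁ g)).dim with hd
  have hle : ∀ F : Finset (Relator g),
      (boundary₂ g F).closureRangeHat.carrier ≤ (boundary₁ g).kerHat.carrier := fun F => by
    refine le_trans ?_ (closureKer_le_kerHat g)
    rw [closureKer_boundary₁_carrier hg]
    exact (le_iSup (fun F : Finset (Relator g) => (boundary₂ g F).closureRangeHat.carrier) F).trans
      (Submodule.le_topologicalClosure _)
  have hdF : ∀ F, d F = (boundary₁ g).kerHat.dim - (boundary₂ g F).closureRangeHat.dim :=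
    fun F => HilbertSubmodule.dim_inf_orthogonal (hle F)
  have hanti : Antitone d := fun F F' h => by
    rw [hdF, hdF, sub_le_sub_iff_left]
    -- Monotonicity of dimension: the relative complement has nonnegative dimension.
    have hnn := ((boundary₂ g F').closureRangeHat.inf
      (boundary₂ g F).closureRangeHat.orthogonal).dim_nonneg
    rw [HilbertSubmodule.dim_inf_orthogonal (monotone_closureRangeHat_boundary₂ h)] at hnn
    linarith
  have hlim : Tendsto d atTop
      (𝓝 ((boundary₁ g).kerHat.dim - (boundary₁ g).closureKer.dim)) := by
    rw [funext hdF]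
    exact tendsto_const_nhds.sub (HilbertSubmodule.tendsto_dim _
      monotone_closureRangeHat_boundary₂ _ (closureKer_boundary₁_carrier hg))
  set l := (boundary₁ g).kerHat.dim - (boundary₁ g).closureKer.dim
  have hinf : ∀ F : Finset (Relator g),
      ⨅ F' : {F' : Finset (Relator g) // F ⊆ F'}, d F'.1 = l := fun F => by
    have : Nonempty {F' : Finset (Relator g) // F ⊆ F'} := ⟨⟨F, subset_rfl⟩⟩
    have hlb : ∀ F', l ≤ d F' := hanti.le_of_tendsto hlim
    refine le_antisymm (le_of_forall_gt fun b hb => ?_) (le_ciInf fun F' => hlb _)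
    obtain ⟨F', hF', hFF⟩ :=
      ((hlim.eventually (gt_mem_nhds hb)).and (eventually_ge_atTop F)).exists
    exact (ciInf_le ⟨l, by rintro _ ⟨F'', rfl⟩; exact hlb _⟩
      (⟨F', hFF⟩ : {F' : Finset (Relator g) // F ⊆ F'})).trans_lt hF'
  change ⨆ F : Finset (Relator g), ⨅ F' : {F' : Finset (Relator g) // F ⊆ F'}, d F'.1 = l
  simp only [hinf, ciSup_const]

variable (g) in
theorem betti₀_eq : betti₀ g = 1 - (boundary₁ g).closureRangeHat.dim := by
  have h : (boundary₀ : EquivariantMap G Unit Empty).kerHat.carrier = ⊤ := by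
    refine eq_top_iff.2 fun f _ => ?_
    change (boundary₀ : EquivariantMap G Unit Empty).hat f = 0
    ext p
    exact p.2.elim
  rw [betti₀, HilbertSubmodule.dim_congr
    (show _ = (boundary₁ g).closureRangeHat.orthogonal.carrier from ?_),
    HilbertSubmodule.dim_orthogonal]
  · simp
  · change _ ⊓ _ = _
    rw [h, top_inf_eq]

/-! ### Bounded coboundaries -/

/-- `δ` is the transpose of `∂₁` for the bilinear pairing with finite chains, which needs no growth
condition on `f`. -/
theorem linearCombination_coboundary (f : G → ℂ) (c : G × Fin n →₀ ℂ) :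
    Finsupp.linearCombination ℂ (coboundary g f) c =
      Finsupp.linearCombination ℂ (fun p : G × Unit => f p.1) ((boundary₁ g).toLin c) := by
  induction c using Finsupp.induction_linear with
  | zero => simp
  | add a b ha hb => rw [map_add, map_add, map_add, ha, hb]
  | single p a =>
    have hp : Finsupp.single p a = a • Finsupp.single p 1 := by simp
    rw [hp, map_smul, map_smul, map_smul, boundary₁_single]
    simp [coboundary]

theorem inner_toL2_right {S : Type*} (u : Ell2 S) (c : S →₀ ℂ) :
    ⟪u, toL2 c⟫_ℂ = Finsupp.linearCombination ℂ (fun s => star (u s)) c := by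
  induction c using Finsupp.induction_linear with
  | zero => simp
  | add a b ha hb => rw [map_add, map_add, inner_add_right, ha, hb]
  | single p a =>
    have hp : Finsupp.single p a = a • Finsupp.single p 1 := by simp
    rw [hp, map_smul, map_smul, inner_smul_right, ← inner_conj_symm, inner_toL2_single]
    simp

/-- Clipping the real and imaginary parts of a complex number to `[-N, N]`. -/
def clip (N : ℝ) (z : ℂ) : ℂ := ⟨max (-N) (min N z.re), max (-N) (min N z.im)⟩

/-- Clipping is 1-Lipschitz in each coordinate. Hence clipping `f` does not increase `δf` at any
edge. -/
theorem norm_clip_sub_clip_le (N : ℝ) (z w : ℂ) : ‖clip N z - clip N w‖ ≤ ‖z - w‖ := by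
  have h : ∀ a b : ℝ, |max (-N) (min N a) - max (-N) (min N b)| ≤ |a - b| := fun a b =>
    (abs_max_sub_max_le_max _ _ _ _).trans <| by
      rw [sub_self, abs_zero]
      refine max_le (abs_nonneg _) ((abs_min_sub_min_le_max _ _ _ _).trans ?_)
      rw [sub_self, abs_zero]
      exact max_le (abs_nonneg _) le_rfl
  rw [← sq_le_sq₀ (norm_nonneg _) (norm_nonneg _), ← Complex.normSq_eq_norm_sq,
    ← Complex.normSq_eq_norm_sq, Complex.normSq_apply, Complex.normSq_apply]
  have h1 := sq_le_sq.2 (h z.re w.re)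
  have h2 := sq_le_sq.2 (h z.im w.im)
  simp only [Complex.sub_re, Complex.sub_im, clip]
  linarith

theorem norm_clip_le {N : ℝ} (hN : 0 ≤ N) (z : ℂ) : ‖clip N z‖ ≤ N + N := by
  have h : ∀ a : ℝ, |max (-N) (min N a)| ≤ N := fun a =>
    abs_le.2 ⟨le_max_left _ _, max_le (by linarith) (min_le_left _ _)⟩
  exact (Complex.norm_le_abs_re_add_abs_im _).trans (add_le_add (h _) (h _))

theorem clip_eq_self {N : ℝ} {z : ℂ} (h : ‖z‖ ≤ N) : clip N z = z := by
  have h1 := abs_le.1 ((Complex.abs_re_le_norm z).trans h)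
  have h2 := abs_le.1 ((Complex.abs_im_le_norm z).trans h)
  apply Complex.ext <;> simp [clip, h1, h2]

/-- Here `f` may be unbounded. The coboundaries of its clippings are dominated by `c` and converge
to it edge by edge, hence in `ℓ²` by dominated convergence. -/
theorem mem_closure_boundedCoboundaries {c : Ell2 (G × Fin n)} {f : G → ℂ}
    (hc : (c : G × Fin n → ℂ) = coboundary g f) :
    c ∈ (boundedCoboundaries g).topologicalClosure := by
  have hle : ∀ (N : ℕ) (p : G × Fin n), ‖coboundary g (fun h => clip N (f h)) p‖ ≤ ‖c p‖ := by
    intro N p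
    rw [hc]
    exact norm_clip_sub_clip_le _ _ _
  have hmem : ∀ N : ℕ, Memℓp (coboundary g fun h => clip N (f h)) 2 := fun N => by
    refine memℓp_gen ?_
    simp only [ENNReal.toReal_ofNat, Real.rpow_ofNat]
    exact (summable_norm_sq c).of_nonneg_of_le (fun _ => by positivity)
      fun p => by gcongr; exact hle N p
  let b : ℕ → Ell2 (G × Fin n) := fun N => ⟨_, hmem N⟩
  have hb : ∀ N, b N ∈ boundedCoboundaries g := fun N =>
    ⟨fun h => clip N (f h), memℓp_infty ⟨N + N, by rintro _ ⟨h, rfl⟩; exact norm_clip_le N.cast_nonneg _⟩, rfl⟩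
  refine mem_closure_of_tendsto (f := b) (b := atTop) ?_ (.of_forall hb)
  rw [tendsto_iff_norm_sub_tendsto_zero]
  have hsq : Tendsto (fun N => ‖b N - c‖ ^ 2) atTop (𝓝 0) := by
    simp only [norm_sq_eq_tsum]
    have hd := tendsto_tsum_of_dominated_convergence (𝓕 := atTop)
      (f := fun N p => ‖(b N - c) p‖ ^ 2) (g := fun _ => (0 : ℝ))
      (bound := fun p => 4 * ‖c p‖ ^ 2) ((summable_norm_sq c).mul_left 4) (fun p => ?_)
      (.of_forall fun N p => ?_)
    · simpa using hd
    -- Once `N` exceeds `‖f‖` at both endpoints, clipping does nothing at this edge.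
    · refine tendsto_const_nhds.congr' ?_
      filter_upwards [eventually_ge_atTop (max ⌈‖f (p.1 * g p.2)‖⌉₊ ⌈‖f p.1‖⌉₊)] with N hN
      have h1 : ‖f (p.1 * g p.2)‖ ≤ N := Nat.ceil_le.1 ((le_max_left _ _).trans hN)
      have h2 : ‖f p.1‖ ≤ N := Nat.ceil_le.1 ((le_max_right _ _).trans hN)
      have h3 : b N p = c p := by
        rw [hc]
        change clip N (f (p.1 * g p.2)) - clip N (f p.1) = f (p.1 * g p.2) - f p.1
        rw [clip_eq_self h1, clip_eq_self h2]
      simp [h3]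
    · have h1 : ‖(b N - c) p‖ ≤ ‖c p‖ + ‖c p‖ :=
        (norm_sub_le _ _).trans (add_le_add_left (hle N p) _)
      rw [Real.norm_of_nonneg (by positivity)]
      nlinarith [norm_nonneg ((b N - c) p)]
  simpa [Real.sqrt_sq] using hsq.sqrt

/-- Coboundaries vanish on cycles. Conversely, a cochain vanishing on finite cycles has
path-independent integrals, which give a primitive. -/
theorem closureBoundedCoboundaries_carrier (hg : Subgroup.closure (Set.range g) = ⊤) :
    (closureBoundedCoboundaries g).carrier = (boundary₁ g).closureKer.orthogonal.carrier := by
  have horth : (boundary₁ g).closureKer.orthogonal.carrier =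
      ((LinearMap.ker (boundary₁ g).toLin).map toL2)ᗮ := Submodule.orthogonal_closure _
  rw [horth]
  refine le_antisymm
    (Submodule.topologicalClosure_minimal _ ?_ (Submodule.isClosed_orthogonal _)) fun c hc => ?_
  · rintro c ⟨f, -, hc⟩
    rw [Submodule.mem_orthogonal']
    rintro _ ⟨x, hx, rfl⟩
    have hx' : (boundary₁ g).toLin x = 0 := hx
    -- The inner product is conjugate-linear in its first slot, so the bilinear pairing is applied
    -- to the conjugate of `f`.
    have hs : (fun s => star (c s)) = coboundary g fun h => star (f h) := by
      ext p
      simp [hc, coboundary]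
    rw [inner_toL2_right, hs, linearCombination_coboundary, hx', map_zero]
  · obtain ⟨k, hk, -⟩ := exists_cone hg
    -- The primitive at `h` integrates `c` over the chosen chain `k h` from `1` to `h`. An edge
    -- together with the chains to its endpoints forms a finite cycle.
    refine mem_closure_boundedCoboundaries (f := fun h => ⟪toL2 (k h), c⟫_ℂ) ?_
    ext p
    have h : (boundary₁ g).toLin (Finsupp.single p 1 + k p.1 - k (p.1 * g p.2)) = 0 := by
      rw [map_sub, map_add, hk, hk, boundary₁_single]
      abel
    have h' := (Submodule.mem_orthogonal _ _).1 hc _ ⟨_, h, rfl⟩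
    rw [map_sub, map_add, inner_sub_left, inner_add_left, inner_toL2_single] at h'
    rw [coboundary]
    linear_combination h'

end Cayley

end L2Betti

theorem mainTheorem5 {G : Type*} [Group G] {n : ℕ} (g : Fin n → G)
    (hg : Subgroup.closure (Set.range g) = ⊤) :
    L2Betti.betti₁ g - L2Betti.betti₀ g + 1 = (n : ℝ) - (L2Betti.boundary₁ g).closureKer.dim ∧
      (n : ℝ) - (L2Betti.boundary₁ g).closureKer.dim =
        (L2Betti.closureBoundedCoboundaries g).dim := by
  constructor
  · have h := (L2Betti.boundary₁ g).dim_kerHat_add_dim_closureRangeHat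
    rw [Fintype.card_fin] at h
    rw [L2Betti.betti₁_eq hg, L2Betti.betti₀_eq]
    linarith
  · rw [L2Betti.HilbertSubmodule.dim_congr (L2Betti.closureBoundedCoboundaries_carrier hg),
      L2Betti.HilbertSubmodule.dim_orthogonal, Fintype.card_fin]
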